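/- Let $n\in\mathbb N$, let $S\subseteq\mathbb F_2^n$ be a (nonempty) set, let $\tau>0$ and $\delta\in(0,1)$ be real numbers, and put $m=\log_2\bigl(|S|(|S|-1)/\delta\bigr)$. Suppose that $$|S|>2^{20}\,m\,\max\Bigl(\frac{2^8(1+\tau)^4}{(\tau\delta)^8},1\Bigr)\qquad\text{and}\qquad m\ge 5\log_2\Bigl(m\max\Bigl(\frac{4(1+\tau)}{(\tau\delta)^2},1\Bigr)\Bigr)+25 .$$ Then there is a natural number $t\le n$ with $$t\ \ge\ \log_2|S|-4\log_2\Bigl(m\max\Bigl(\frac{4(1+\tau)}{(\tau\delta)^2},1\Bigr)\Bigr)-20$$ such that, for at least a $(1-\delta)$-fraction of all surjective linear maps $L:\mathbb F_2^n\to\mathbb F_2^t$, the distribution of $L(U_S)$, where $U_S$ is uniformly distributed on $S$, is $\tau 2^{-t}$-close to uniform in the $\ell_\infty$ norm, that is, $$\bigl|\Pr[L(U_S)=y]-2^{-t}\bigr|\le\tau 2^{-t}\qquad\text{for every }y\in\mathbb F_2^t .$$ -/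

import Mathlib

noncomputable section

/-- The law of `L(U_S)`, where `U_S` is uniformly distributed on the nonempty finite set `S`. -/
def hashLaw {V W : Type*} (S : Finset V) (hS : S.Nonempty) (L : V → W) : PMF W :=
  (PMF.uniformOfFinset S hS).map L

/-- The probability distributions `p` and `q` are `ε`-close in the `ℓ_∞` norm. -/
def IsLinftyClose {W : Type*} (p q : PMF W) (ε : ℝ) : Prop :=
  ∀ y : W, |(p y).toReal - (q y).toReal| ≤ ε

/-- The set of all surjective linear maps `𝔽₂ⁿ → 𝔽₂ᵗ`. -/
def surjLinearMaps (n t : ℕ) : Set ((Fin n → ZMod 2) →ₗ[ZMod 2] (Fin t → ZMod 2)) :=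
  {L | Function.Surjective L}

/-- The surjective linear maps `L : 𝔽₂ⁿ → 𝔽₂ᵗ` for which `L(U_S)` is `τ 2^{-t}`-close to the uniform
distribution on `𝔽₂ᵗ` in the `ℓ_∞` norm. -/
def goodLinearMaps {n : ℕ} (S : Finset (Fin n → ZMod 2)) (hS : S.Nonempty) (τ : ℝ) (t : ℕ) :
    Set ((Fin n → ZMod 2) →ₗ[ZMod 2] (Fin t → ZMod 2)) :=
  {L ∈ surjLinearMaps n t |
    IsLinftyClose (hashLaw S hS L) (PMF.uniformOfFintype (Fin t → ZMod 2)) (τ * (2 ^ t)⁻¹)}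

end

/-! Let `W = 𝔽₂ᵗ` and adjoin to `L` an independent uniform linear map `M` into `𝔽₂ᵏ`, where `2 ^ k`
is between `t` and `2t`. If `L` has a bad fibre over `y`, then by Chebyshev at least half of all `M`
split that fibre so evenly that every load at `(y, b)` is atypical
(`half_card_le_card_forall_le_abs_hashLoad_sub`). Hence the density of bad `L` is at most twice that
of pairs `(L, M)` with an entirely atypical column `{a} × 𝔽₂ᵏ`.

The law of `(L, M)` is invariant under the shears `(L - H M, M)`, so columns may be replaced by
random graphs `{(a + H b, b)}`. By Chebyshev the atypical points are sparse on average. Revealing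
the columns of `H` one at a time roughly squares the density of the admissible `a`; after `k` steps
it is below `1 / |W|`, so no admissible `a` is left (`card_exists_forall_add_mem_le`). This bounds
the bad maps by a `δ / 2` fraction of all linear maps. As `t < n`, at least half of all maps are
surjective, which costs a final factor 2. The case `t = 0` is trivial. -/

open Finset

/-! ### Loads and their second moments. -/

/-- The number of elements of `S` that `h` sends to `y`. -/
def hashLoad {X Y : Type*} [DecidableEq Y] (S : Finset X) (h : X → Y) (y : Y) : ℕ :=
  #{x ∈ S | h x = y}

lemma sum_hashLoad {X Y : Type*} [Fintype Y] [DecidableEq Y] (S : Finset X) (h : X → Y) :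
    ∑ y, (hashLoad S h y : ℝ) = #S := by
  rw [Finset.card_eq_sum_card_fiberwise (f := h) (t := Finset.univ) (fun _ _ => by simp)]
  push_cast
  rfl

lemma sum_hashLoad_sq {X Y : Type*} [Fintype Y] [DecidableEq Y] (S : Finset X) (h : X → Y) :
    ∑ y, (hashLoad S h y : ℝ) ^ 2 = ∑ x ∈ S, ∑ x' ∈ S, if h x = h x' then (1 : ℝ) else 0 := by
  have key : ∀ y, (hashLoad S h y : ℝ) ^ 2 =
      ∑ x ∈ S, ∑ x' ∈ S, if h x = y then (if h x' = y then (1 : ℝ) else 0) else 0 := by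
    intro y
    have h1 : (hashLoad S h y : ℝ) = ∑ x ∈ S, if h x = y then (1 : ℝ) else 0 := by
      simp [hashLoad]
    rw [h1, sq, Finset.sum_mul_sum]
    refine Finset.sum_congr rfl fun x _ => Finset.sum_congr rfl fun x' _ => ?_
    split_ifs <;> simp
  simp_rw [key]
  rw [Finset.sum_comm]
  refine Finset.sum_congr rfl fun x _ => ?_
  rw [Finset.sum_comm]
  refine Finset.sum_congr rfl fun x' _ => ?_
  rw [Finset.sum_ite_eq]
  simp [eq_comm]

lemma sum_hashLoad_sub_sq {X Y : Type*} [Fintype Y] [Nonempty Y] [DecidableEq Y]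
    (S : Finset X) (h : X → Y) :
    ∑ y, ((hashLoad S h y : ℝ) - #S / Fintype.card Y) ^ 2 =
      ∑ y, (hashLoad S h y : ℝ) ^ 2 - (#S : ℝ) ^ 2 / Fintype.card Y := by
  have hY : (Fintype.card Y : ℝ) ≠ 0 := by exact_mod_cast Fintype.card_ne_zero
  simp_rw [sub_sq, Finset.sum_add_distrib, Finset.sum_sub_distrib]
  rw [← Finset.sum_mul, ← Finset.mul_sum, sum_hashLoad]
  simp only [Finset.sum_const, Finset.card_univ, nsmul_eq_mul]
  field_simp
  ring

/-- Under a universal family of hash functions the loads have total variance at most `|S|`. -/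
lemma sum_sum_hashLoad_sub_sq_le {Ω X Y : Type*} [Fintype Ω] [Fintype Y] [Nonempty Y]
    [DecidableEq Y] [DecidableEq X] (S : Finset X) (h : Ω → X → Y)
    (hU : ∀ x x', x ≠ x' → (#{ω | h ω x = h ω x'} : ℝ) * Fintype.card Y ≤ Fintype.card Ω) :
    ∑ ω, ∑ y, ((hashLoad S (h ω) y : ℝ) - #S / Fintype.card Y) ^ 2 ≤ #S * Fintype.card Ω := by
  have hY : (0 : ℝ) < Fintype.card Y := by exact_mod_cast Fintype.card_pos
  simp_rw [sum_hashLoad_sub_sq, Finset.sum_sub_distrib, sum_hashLoad_sq]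
  have h1 : ∑ ω, ∑ x ∈ S, ∑ x' ∈ S, (if h ω x = h ω x' then (1 : ℝ) else 0) ≤
      ∑ x ∈ S, ∑ x' ∈ S, ((if x = x' then (Fintype.card Ω : ℝ) else 0) +
        Fintype.card Ω / Fintype.card Y) := by
    rw [Finset.sum_comm]
    refine Finset.sum_le_sum fun x _ => ?_
    rw [Finset.sum_comm]
    refine Finset.sum_le_sum fun x' _ => ?_
    rw [Finset.sum_boole]
    split_ifs with hx
    · subst hx
      have : (0 : ℝ) ≤ Fintype.card Ω / Fintype.card Y := by positivity
      simpa using this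
    · rw [zero_add, le_div_iff₀ hY]
      exact hU x x' hx
  refine (sub_le_sub_right h1 _).trans (le_of_eq ?_)
  simp only [Finset.sum_add_distrib, Finset.sum_ite_eq, Finset.sum_const, nsmul_eq_mul,
    Finset.card_univ]
  rw [Finset.sum_ite_mem, Finset.inter_self, Finset.sum_const, nsmul_eq_mul]
  ring

/-- Markov's inequality for a nonnegative function on a finite type. -/
lemma card_filter_mul_le_sum {Ω : Type*} [Fintype Ω] (f : Ω → ℝ) (hf : ∀ ω, 0 ≤ f ω) (r : ℝ)
    (p : Ω → Prop) [DecidablePred p] (hp : ∀ ω, p ω → r ≤ f ω) :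
    (#{ω | p ω} : ℝ) * r ≤ ∑ ω, f ω := by
  calc (#{ω | p ω} : ℝ) * r = ∑ ω with p ω, r := by simp
    _ ≤ ∑ ω with p ω, f ω := Finset.sum_le_sum fun ω hω => hp ω (by simpa using hω)
    _ ≤ ∑ ω, f ω := Finset.sum_le_sum_of_subset_of_nonneg (Finset.filter_subset _ _)
        fun ω _ _ => hf ω

/-! ### Random graphs avoid sparse families. -/

/-- The translates of `B` by a uniform element meet `A` in `|A||B|/|G|` elements on average. -/
lemma sum_card_filter_mem_add_mem {G : Type*} [AddCommGroup G] [Fintype G] [DecidableEq G]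
    (A B : Finset G) :
    ∑ v : G, (#{a ∈ A | a + v ∈ B} : ℝ) = #A * #B := by
  have : ∀ v : G, (#{a ∈ A | a + v ∈ B} : ℝ) = ∑ a ∈ A, if a + v ∈ B then (1 : ℝ) else 0 := by
    intro v
    simp
  simp_rw [this]
  rw [Finset.sum_comm]
  have h2 : ∀ a : G, (∑ v : G, if a + v ∈ B then (1 : ℝ) else 0) = #B := by
    intro a
    exact (Equiv.sum_comp (Equiv.addLeft a) (fun u => if u ∈ B then (1 : ℝ) else 0)).trans
      (by simp)
  simp [h2]

/-- If all the sets `A b` are sparse, then for most `w` no coset of the graph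
`{(∑ bᵢ wᵢ, b)}` is contained in `{(a, b) | a ∈ A b}`. -/
theorem card_exists_forall_add_mem_le {W : Type*} [AddCommGroup W] [Module (ZMod 2) W] [Fintype W]
    [DecidableEq W] (c : ℝ) (hc : 0 < c) (k : ℕ) (α : ℝ) (hα : 0 < α)
    (hsmall : (c * α) ^ 2 ^ k * Fintype.card W < c)
    (A : (Fin k → ZMod 2) → Finset W) (hA : ∀ b, (#(A b) : ℝ) ≤ α * Fintype.card W) :
    (#{w : Fin k → W | ∃ a, ∀ b, a + ∑ i, b i • w i ∈ A b} : ℝ) ≤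
      2 ^ k / c * (Fintype.card W : ℝ) ^ k := by
  have hW : (0 : ℝ) < Fintype.card W := by exact_mod_cast Fintype.card_pos
  induction k generalizing α with
  | zero =>
    -- With no columns left, `hsmall` says `α |W| < 1`, which forces the only set to be empty.
    have h0 : #(A 0) = 0 := by
      have h1 : α * Fintype.card W < 1 := by
        have : c * (α * Fintype.card W) < c * 1 := by
          calc c * (α * Fintype.card W) = (c * α) ^ 2 ^ 0 * Fintype.card W := by ring
            _ < c * 1 := by simpa using hsmall
        exact lt_of_mul_lt_mul_left this hc.le
      have h2 : (#(A 0) : ℝ) < 1 := (hA 0).trans_lt h1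
      exact_mod_cast Nat.lt_one_iff.mp (by exact_mod_cast h2)
    rw [Finset.card_eq_zero] at h0
    have : ∀ w : Fin 0 → W, ¬ ∃ a, ∀ b, a + ∑ i, b i • w i ∈ A b := by
      rintro w ⟨a, ha⟩
      have := ha 0
      rw [h0] at this
      exact absurd this (Finset.notMem_empty _)
    rw [Finset.filter_false_of_mem (fun w _ => this w)]
    simp only [Finset.card_empty, Nat.cast_zero]
    positivity
  | succ k ih =>
    -- Once the first column is `v`, the conditions for `0 :: b` and `1 :: b` merge into one
    -- condition on `a`.
    let A' : W → (Fin k → ZMod 2) → Finset W := fun v b =>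
      {a ∈ A (Fin.cons 0 b) | a + v ∈ A (Fin.cons 1 b)}
    -- Over random `v`, each `A' v b` has mean density at most `α²`. Markov with factor `c` and a
    -- sum over the `2 ^ k` values of `b` give `2 ^ k / c`.
    let bad : W → Prop := fun v => ∃ b, c * α ^ 2 * Fintype.card W ≤ #(A' v b)
    classical
    have hbad : (#{v | bad v} : ℝ) ≤ 2 ^ k / c * Fintype.card W := by
      have h1 := card_filter_mul_le_sum (fun v => ∑ b, (#(A' v b) : ℝ))
        (fun v => by positivity) (c * α ^ 2 * Fintype.card W) bad (by
          rintro v ⟨b, hb⟩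
          exact hb.trans (Finset.single_le_sum (f := fun b => (#(A' v b) : ℝ))
            (fun _ _ => by positivity) (Finset.mem_univ b)))
      have h2 : ∑ v, ∑ b, (#(A' v b) : ℝ) ≤ 2 ^ k * (α * Fintype.card W) ^ 2 := by
        rw [Finset.sum_comm]
        calc ∑ b, ∑ v, (#(A' v b) : ℝ)
            ≤ ∑ b : Fin k → ZMod 2, (α * Fintype.card W) ^ 2 := by
              refine Finset.sum_le_sum fun b _ => ?_
              rw [sum_card_filter_mem_add_mem, sq]
              exact mul_le_mul (hA _) (hA _) (by positivity) (by positivity)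
          _ = _ := by simp
      have h3 := h1.trans h2
      have hpos : 0 < α ^ 2 * Fintype.card W := by positivity
      rw [div_mul_eq_mul_div, le_div_iff₀ hc]
      refine le_of_mul_le_mul_right ?_ hpos
      calc _ = (#{v | bad v} : ℝ) * (c * α ^ 2 * Fintype.card W) := by ring
        _ ≤ _ := h3
        _ = _ := by ring
    have hsplit : (#{w : Fin (k + 1) → W | ∃ a, ∀ b, a + ∑ i, b i • w i ∈ A b} : ℝ) ≤
        ∑ v, (#{w : Fin k → W | ∃ a, ∀ b, a + ∑ i, b i • w i ∈ A' v b} : ℝ) := by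
      simp_rw [← Finset.sum_boole]
      rw [← Fintype.sum_prod_type', ← Equiv.sum_comp (Fin.consEquiv (fun _ => W))]
      refine Finset.sum_le_sum fun p _ => ?_
      by_cases h : ∃ a, ∀ b, a + ∑ i, b i • (Fin.consEquiv (fun _ => W)) p i ∈ A b
      · rw [if_pos h, if_pos]
        obtain ⟨a, ha⟩ := h
        refine ⟨a, fun b => ?_⟩
        have h0 := ha (Fin.cons 0 b)
        have h1 := ha (Fin.cons 1 b)
        simp only [Fin.sum_univ_succ, Fin.consEquiv_apply, Fin.cons_zero, Fin.cons_succ, zero_smul,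
          zero_add, one_smul] at h0 h1
        simp only [A', Finset.mem_filter]
        refine ⟨h0, ?_⟩
        convert h1 using 1
        abel
      · rw [if_neg h]
        split_ifs <;> simp
    refine hsplit.trans ?_
    calc ∑ v, (#{w : Fin k → W | ∃ a, ∀ b, a + ∑ i, b i • w i ∈ A' v b} : ℝ)
        ≤ ∑ v, ((if bad v then (Fintype.card W : ℝ) ^ k else 0) +
            2 ^ k / c * (Fintype.card W : ℝ) ^ k) := by
          refine Finset.sum_le_sum fun v _ => ?_
          split_ifs with hv
          · have h1 : (#{w : Fin k → W | ∃ a, ∀ b, a + ∑ i, b i • w i ∈ A' v b} : ℝ) ≤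
                (Fintype.card W : ℝ) ^ k := by
              have := Finset.card_le_univ
                {w : Fin k → W | ∃ a, ∀ b, a + ∑ i, b i • w i ∈ A' v b}
              rw [Fintype.card_fun, Fintype.card_fin] at this
              exact_mod_cast this
            have h2 : (0 : ℝ) ≤ 2 ^ k / c * (Fintype.card W : ℝ) ^ k := by positivity
            linarith
          · rw [zero_add]
            simp only [bad, not_exists, not_le] at hv
            -- Since `c * (c α²) = (c α)²`, the smallness hypothesis is inherited with one squaring
            -- fewer.
            refine ih (c * α ^ 2) (by positivity) ?_ (A' v) fun b => (hv b).le
            calc (c * (c * α ^ 2)) ^ 2 ^ k * Fintype.card W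
                = (c * α) ^ 2 ^ (k + 1) * Fintype.card W := by
                  rw [pow_succ 2 k, mul_comm (2 ^ k) 2, pow_mul]; ring
              _ < c := hsmall
      _ = #{v | bad v} * (Fintype.card W : ℝ) ^ k +
            Fintype.card W * (2 ^ k / c * (Fintype.card W : ℝ) ^ k) := by
          rw [Finset.sum_add_distrib, ← Finset.sum_filter]
          simp
      _ ≤ 2 ^ k / c * Fintype.card W * (Fintype.card W : ℝ) ^ k +
            Fintype.card W * (2 ^ k / c * (Fintype.card W : ℝ) ^ k) := by gcongr
      _ = _ := by ring

/-! ### Counting linear maps. -/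

lemma card_fiber_mul_card_of_surjective {G H : Type*} [AddGroup G] [AddGroup H] [Fintype G]
    [Fintype H] [DecidableEq H] (f : G →+ H) (hf : Function.Surjective f) (w : H) :
    #{g | f g = w} * Fintype.card H = Fintype.card G := by
  have hcard : ∀ y, #{g | f g = y} = #{g | f g = w} := by
    intro y
    obtain ⟨g₀, hg₀⟩ := hf (-y + w)
    refine Finset.card_equiv (Equiv.addRight g₀) fun g => ?_
    simp only [Finset.mem_filter, Finset.mem_univ, true_and, Equiv.coe_addRight, map_add, hg₀]
    rw [← add_assoc, add_eq_right, add_neg_eq_zero]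
  have hsum : Fintype.card G = ∑ y, #{g | f g = y} :=
    Finset.card_eq_sum_card_fiberwise fun _ _ => by simp
  rw [hsum, Finset.sum_congr rfl fun y _ => hcard y]
  simp [mul_comm]

/-- Evaluation at the nonzero vector `x - x'` is onto `W`, by rank-one maps, so its fibres have
equal size. Uniform linear maps thus form a universal hash family. -/
lemma card_linearMap_collision_mul {K V W : Type*} [Field K] [AddCommGroup V] [Module K V]
    [AddCommGroup W] [Module K W] [Fintype W] [DecidableEq W] [Fintype (V →ₗ[K] W)]
    {x x' : V} (hx : x ≠ x') :
    #{M : V →ₗ[K] W | M x = M x'} * Fintype.card W = Fintype.card (V →ₗ[K] W) := by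
  obtain ⟨φ, hφ⟩ : ∃ φ : Module.Dual K V, φ (x - x') ≠ 0 := by
    by_contra! h
    exact sub_ne_zero.2 hx ((Module.forall_dual_apply_eq_zero_iff K (x - x')).1 h)
  rw [← card_fiber_mul_card_of_surjective (LinearMap.applyₗ (R := K) (M₂ := W) (x - x')).toAddMonoidHom
    (fun y => ⟨φ.smulRight ((φ (x - x'))⁻¹ • y), by
      simp [-map_sub, smul_smul, hφ]⟩) 0]
  simp [sub_eq_zero]

/-- If a set `T` has an atypical size, then hashing `T` spreads it so evenly that with probability
at least `1/2` every load is atypical. -/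
lemma half_card_le_card_forall_le_abs_hashLoad_sub {K V B : Type*} [Field K] [AddCommGroup V]
    [Module K V] [DecidableEq V] [AddCommGroup B] [Module K B] [Fintype B] [DecidableEq B]
    [Fintype (V →ₗ[K] B)] (T : Finset V) (τ l : ℝ) (hτ : 0 < τ) (hl : 0 < l)
    (hbig : 16 * Fintype.card B * (1 + τ) ≤ τ ^ 2 * l)
    (hT : τ * l < |(#T : ℝ) / Fintype.card B - l|) :
    (Fintype.card (V →ₗ[K] B) : ℝ) / 2 ≤
      #{M : V →ₗ[K] B | ∀ b, τ * l / 2 ≤ |(hashLoad T M b : ℝ) - l|} := by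
  have hB : (0 : ℝ) < Fintype.card B := by exact_mod_cast Fintype.card_pos
  set s : ℝ := (#T : ℝ) / Fintype.card B with hs
  have hTs : (#T : ℝ) = Fintype.card B * s := by rw [hs]; field_simp
  set u := |s - l| with hu
  have hu0 : 0 < u := lt_trans (by positivity) hT
  have hvar := sum_sum_hashLoad_sub_sq_le T (fun (M : V →ₗ[K] B) x => M x) (by
    intro x x' hx
    exact_mod_cast (card_linearMap_collision_mul (K := K) (W := B) hx).le)
  rw [← hs] at hvar
  let bad : (V →ₗ[K] B) → Prop := fun M => ¬ ∀ b, τ * l / 2 ≤ |(hashLoad T M b : ℝ) - l|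
  classical
  have hM := card_filter_mul_le_sum
    (fun M : V →ₗ[K] B => ∑ b, ((hashLoad T M b : ℝ) - s) ^ 2)
    (fun M => by positivity) ((u / 2) ^ 2) bad (by
      intro M hM
      simp only [bad, not_forall, not_le] at hM
      obtain ⟨b, hb⟩ := hM
      refine le_trans ?_ (Finset.single_le_sum (f := fun b => ((hashLoad T M b : ℝ) - s) ^ 2)
        (fun _ _ => by positivity) (Finset.mem_univ b))
      rw [← sq_abs ((hashLoad T M b : ℝ) - s)]
      -- A load within `τ l / 2 < u / 2` of `l` lies at least `u / 2` from the mean `s`.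
      have : u ≤ |(hashLoad T M b : ℝ) - s| + |(hashLoad T M b : ℝ) - l| := by
        rw [hu, abs_sub_comm (hashLoad T M b : ℝ) s]
        exact abs_sub_le _ _ _
      gcongr
      linarith)
  have hbad : (#{M | bad M} : ℝ) ≤ Fintype.card (V →ₗ[K] B) / 2 := by
    have h1 := hM.trans hvar
    -- This makes the Markov bound `|T| / (u / 2)²` at most `1 / 2`. It uses `|T| = |B| s ≤ |B| (l +
    -- u)` and compares `(l + u) τ² l` with `(1 + τ) u²` through `τ l < u`.
    have h2 : 2 * (#T : ℝ) ≤ (u / 2) ^ 2 := by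
      have hsu : s ≤ l + u := by
        have := le_abs_self (s - l)
        linarith
      have h3 : 8 * Fintype.card B * (l + u) * (1 + τ) * 2 ≤ (l + u) * (τ ^ 2 * l) := by
        nlinarith [mul_le_mul_of_nonneg_left hbig (by positivity : 0 ≤ l + u)]
      have h4 : (l + u) * (τ ^ 2 * l) ≤ 2 * ((1 + τ) * u ^ 2) := by
        have h6 : (τ * l) * (τ * l) ≤ u * u := mul_self_le_mul_self (by positivity) hT.le
        have h7 : τ * u * (τ * l) ≤ τ * u * u := mul_le_mul_of_nonneg_left hT.le (by positivity)
        nlinarith [mul_pos hτ (mul_pos hu0 hu0), mul_pos hu0 hu0]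
      have h5 : 8 * Fintype.card B * (l + u) ≤ u ^ 2 := by
        have : (8 * Fintype.card B * (l + u)) * (2 * (1 + τ)) ≤ u ^ 2 * (2 * (1 + τ)) := by
          linarith
        exact le_of_mul_le_mul_right this (by positivity)
      rw [hTs]
      nlinarith [mul_le_mul_of_nonneg_left hsu hB.le]
    have hpos : 0 < (u / 2) ^ 2 := by positivity
    refine le_of_mul_le_mul_right (h1.trans ?_) hpos
    have : (0 : ℝ) ≤ Fintype.card (V →ₗ[K] B) := by positivity
    nlinarith [mul_le_mul_of_nonneg_left h2 this]
  have hsum := Finset.card_filter_add_card_filter_not (s := (Finset.univ : Finset (V →ₗ[K] B)))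
    (p := fun M => ∀ b, τ * l / 2 ≤ |(hashLoad T M b : ℝ) - l|)
  have hsum' : (#{M : V →ₗ[K] B | ∀ b, τ * l / 2 ≤ |(hashLoad T M b : ℝ) - l|} : ℝ) +
      #{M | bad M} = Fintype.card (V →ₗ[K] B) := by
    rw [← Finset.card_univ, ← hsum]
    push_cast
    congr!
  linarith

/-- At most a fraction `|W| / |V|` of all linear maps `V → W` fails to be surjective. -/
lemma card_not_surjective_mul_le {K V W : Type*} [Field K] [Fintype K] [AddCommGroup V] [Module K V]
    [AddCommGroup W] [Module K W] [Fintype V] [Fintype W] [Fintype (V →ₗ[K] W)]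
    [DecidablePred fun L : V →ₗ[K] W => ¬ Function.Surjective L] :
    #{L : V →ₗ[K] W | ¬ Function.Surjective L} * Fintype.card V ≤
      Fintype.card W * Fintype.card (V →ₗ[K] W) := by
  classical
  have : Finite (Module.Dual K V) := Module.finite_of_finite K
  have : Finite (Module.Dual K W) := Module.finite_of_finite K
  have := Fintype.ofFinite (Module.Dual K V)
  have := Fintype.ofFinite (Module.Dual K W)
  have hV : Fintype.card (Module.Dual K V) = Fintype.card V := by
    rw [Module.card_eq_pow_finrank (K := K), Module.card_eq_pow_finrank (K := K) (V := V),
      Subspace.dual_finrank_eq]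
  have hW : Fintype.card (Module.Dual K W) = Fintype.card W := by
    rw [Module.card_eq_pow_finrank (K := K), Module.card_eq_pow_finrank (K := K) (V := W),
      Subspace.dual_finrank_eq]
  have hcount : ∀ φ : Module.Dual K W, φ ≠ 0 →
      #{L : V →ₗ[K] W | φ ∘ₗ L = 0} * Fintype.card V = Fintype.card (V →ₗ[K] W) := by
    intro φ hφ
    obtain ⟨w, hw⟩ : ∃ w, φ w ≠ 0 := by
      by_contra! h
      exact hφ (LinearMap.ext h)
    rw [← hV]
    exact card_fiber_mul_card_of_surjective (LinearMap.compRight K φ (M := V)).toAddMonoidHom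
      (fun ψ => ⟨ψ.smulRight ((φ w)⁻¹ • w), by
        ext v
        simp [hw]⟩) 0
  -- Union bound: a proper range is killed by some nonzero functional `φ`, and `φ ∘ L = 0` holds for
  -- exactly a `1 / |V|` fraction of the maps.
  have hsub : ({L : V →ₗ[K] W | ¬ Function.Surjective L} : Finset _) ⊆
      ({φ : Module.Dual K W | φ ≠ 0} : Finset _).biUnion fun φ => {L | φ ∘ₗ L = 0} := by
    intro L hL
    simp only [Finset.mem_filter, Finset.mem_univ, true_and, Finset.mem_biUnion] at hL ⊢
    rw [← LinearMap.range_eq_top] at hL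
    obtain ⟨φ, hφ, hφL⟩ := Submodule.exists_le_ker_of_lt_top _ (lt_top_iff_ne_top.2 hL)
    exact ⟨φ, hφ, LinearMap.range_le_ker_iff.1 hφL⟩
  calc #{L : V →ₗ[K] W | ¬ Function.Surjective L} * Fintype.card V
      ≤ (∑ φ : Module.Dual K W with φ ≠ 0, #{L : V →ₗ[K] W | φ ∘ₗ L = 0}) * Fintype.card V := by
        gcongr
        exact (Finset.card_le_card hsub).trans Finset.card_biUnion_le
    _ = ∑ φ : Module.Dual K W with φ ≠ 0, Fintype.card (V →ₗ[K] W) := by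
        rw [Finset.sum_mul]
        exact Finset.sum_congr rfl fun φ hφ => hcount φ (by simpa using hφ)
    _ ≤ _ := by
        rw [Finset.sum_const, smul_eq_mul, ← hW]
        gcongr
        exact Finset.card_le_univ _

/-! ### From random graphs to random linear maps. -/

/-- The covering bound with the parameters chosen, for families that need not be sparse. -/
lemma card_exists_forall_add_mem_le_sum {W : Type*} [AddCommGroup W] [Module (ZMod 2) W]
    [Fintype W] [DecidableEq W] {k : ℕ} (δ : ℝ) (hδ₀ : 0 < δ) (hδ₁ : δ < 1)
    (hW : Fintype.card W ≤ 2 ^ 2 ^ k) (A : (Fin k → ZMod 2) → Finset W) :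
    (#{w : Fin k → W | ∃ a, ∀ b, a + ∑ i, b i • w i ∈ A b} : ℝ) ≤
      (δ / 8 + (∑ b, (#(A b) : ℝ)) / (δ / (16 * 2 ^ k) * Fintype.card W)) *
        (Fintype.card W : ℝ) ^ k := by
  have hWpos : (0 : ℝ) < Fintype.card W := by exact_mod_cast Fintype.card_pos
  -- The choice gives `c α = 1 / 2`, so that `(c α) ^ 2 ^ k * |W| ≤ 1 < c`, and failure probability
  -- `2 ^ k / c = δ / 8`.
  obtain ⟨α, hα⟩ : ∃ α : ℝ, α = δ / (16 * 2 ^ k) := ⟨_, rfl⟩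
  obtain ⟨c, hc⟩ : ∃ c : ℝ, c = 8 * 2 ^ k / δ := ⟨_, rfl⟩
  have hkc : 2 ^ k / c = δ / 8 := by rw [hc]; field_simp
  have hαpos : 0 < α := by rw [hα]; positivity
  have hcpos : 0 < c := by rw [hc]; positivity
  have hsmall : (c * α) ^ 2 ^ k * Fintype.card W < c := by
    have h1 : c * α = 1 / 2 := by rw [hα, hc]; field_simp; norm_num
    have h2 : (c * α) ^ 2 ^ k * Fintype.card W ≤ 1 := by
      rw [h1, one_div, inv_pow, inv_mul_le_one₀ (by positivity)]
      exact_mod_cast hW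
    have h3 : 1 < c := by
      rw [hc, lt_div_iff₀ hδ₀]
      have : (1 : ℝ) ≤ 2 ^ k := one_le_pow₀ (by norm_num)
      linarith
    exact h2.trans_lt h3
  rw [← hα]
  by_cases hp : ∀ b, (#(A b) : ℝ) ≤ α * Fintype.card W
  · refine (card_exists_forall_add_mem_le c hcpos k α hαpos hsmall A hp).trans ?_
    rw [hkc]
    gcongr
    have : 0 ≤ (∑ b, (#(A b) : ℝ)) / (α * Fintype.card W) := by positivity
    linarith
  -- If some set is not sparse, the second summand alone is at least 1 and the bound is trivial.
  · push Not at hp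
    obtain ⟨b, hb⟩ := hp
    have h1 : (#{w : Fin k → W | ∃ a, ∀ b, a + ∑ i, b i • w i ∈ A b} : ℝ) ≤
        (Fintype.card W : ℝ) ^ k := by
      have := Finset.card_le_univ {w : Fin k → W | ∃ a, ∀ b, a + ∑ i, b i • w i ∈ A b}
      rw [Fintype.card_fun, Fintype.card_fin] at this
      exact_mod_cast this
    refine h1.trans (le_mul_of_one_le_left (by positivity) ?_)
    have h2 : 1 ≤ (∑ b, (#(A b) : ℝ)) / (α * Fintype.card W) := by
      rw [one_le_div (by positivity)]
      exact hb.le.trans (Finset.single_le_sum (f := fun b => (#(A b) : ℝ))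
        (fun _ _ => by positivity) (Finset.mem_univ b))
    linarith

section Shear

variable {V W : Type*} [AddCommGroup V] [Module (ZMod 2) V] [AddCommGroup W] [Module (ZMod 2) W]

/-- The shear `(L, M) ↦ (L - H M, M)`, where `H b = ∑ bᵢ wᵢ`. -/
def shearLinearMaps {k : ℕ} (w : Fin k → W) :
    (V →ₗ[ZMod 2] W) × (V →ₗ[ZMod 2] (Fin k → ZMod 2)) ≃
      (V →ₗ[ZMod 2] W) × (V →ₗ[ZMod 2] (Fin k → ZMod 2)) where
  toFun p := (p.1 - Fintype.linearCombination (ZMod 2) w ∘ₗ p.2, p.2)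
  invFun p := (p.1 + Fintype.linearCombination (ZMod 2) w ∘ₗ p.2, p.2)
  left_inv p := by simp
  right_inv p := by simp

/-- The map `x ↦ (L x, M x)` for a pair `(L, M)` of linear maps. -/
def pairEval {k : ℕ} (p : (V →ₗ[ZMod 2] W) × (V →ₗ[ZMod 2] (Fin k → ZMod 2))) (x : V) :
    W × (Fin k → ZMod 2) :=
  (p.1 x, p.2 x)

/-- With `M x = b`, the equation `L x - H (M x) = a` reads `L x = a + H b`. -/
lemma hashLoad_shearLinearMaps [DecidableEq W] {k : ℕ} (S : Finset V) (w : Fin k → W)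
    (p : (V →ₗ[ZMod 2] W) × (V →ₗ[ZMod 2] (Fin k → ZMod 2))) (a : W) (b : Fin k → ZMod 2) :
    hashLoad S (pairEval (shearLinearMaps w p)) (a, b) =
      hashLoad S (pairEval p) (a + ∑ i, b i • w i, b) := by
  unfold hashLoad
  congr 1
  refine Finset.filter_congr fun x _ => ?_
  simp only [pairEval, shearLinearMaps, Equiv.coe_fn_mk, Prod.mk.injEq, LinearMap.sub_apply,
    LinearMap.comp_apply, Fintype.linearCombination_apply]
  constructor
  · rintro ⟨h, rfl⟩
    exact ⟨by rw [← h]; abel, rfl⟩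
  · rintro ⟨h, rfl⟩
    exact ⟨by rw [h]; abel, rfl⟩

open scoped Classical in
/-- The elements `a` for which the load of `(a, b)` differs from `l` by at least `r`. -/
noncomputable def atypicalSlice [Fintype W] [DecidableEq W] {k : ℕ} (S : Finset V) (l r : ℝ)
    (p : (V →ₗ[ZMod 2] W) × (V →ₗ[ZMod 2] (Fin k → ZMod 2))) (b : Fin k → ZMod 2) : Finset W :=
  {a | r ≤ |(hashLoad S (pairEval p) (a, b) : ℝ) - l|}

variable [Fintype W] [DecidableEq W] [DecidableEq V] [Fintype (V →ₗ[ZMod 2] W)] {k : ℕ}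
  [Fintype (V →ₗ[ZMod 2] (Fin k → ZMod 2))]

/-- Chebyshev's inequality: `l` is the mean load, and `(L, M)` is universal because its two
components collide independently. -/
lemma sum_sum_card_atypicalSlice_mul_le (S : Finset V) (l r : ℝ) (hr : 0 ≤ r)
    (hl : #S = l * (Fintype.card W * 2 ^ k)) :
    (∑ p : (V →ₗ[ZMod 2] W) × (V →ₗ[ZMod 2] (Fin k → ZMod 2)), ∑ b,
      (#(atypicalSlice S l r p b) : ℝ)) * r ^ 2 ≤
      #S * Fintype.card ((V →ₗ[ZMod 2] W) × (V →ₗ[ZMod 2] (Fin k → ZMod 2))) := by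
  have hl' : l = #S / Fintype.card (W × (Fin k → ZMod 2)) := by
    have : (Fintype.card W : ℝ) ≠ 0 := by exact_mod_cast Fintype.card_ne_zero
    rw [hl]
    simp
  rw [hl']
  refine le_trans ?_ (sum_sum_hashLoad_sub_sq_le (Y := W × (Fin k → ZMod 2)) S
    (fun p : (V →ₗ[ZMod 2] W) × (V →ₗ[ZMod 2] (Fin k → ZMod 2)) => pairEval p) ?_)
  · rw [Finset.sum_mul]
    refine Finset.sum_le_sum fun p _ => ?_
    rw [Fintype.sum_prod_type_right, Finset.sum_mul]
    refine Finset.sum_le_sum fun b _ => ?_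
    refine card_filter_mul_le_sum _ (fun a => by positivity) _ _ fun a ha => ?_
    rw [← sq_abs ((hashLoad S (pairEval p) (a, b) : ℝ) - _)]
    gcongr
  · intro x x' hx
    have h1 := card_linearMap_collision_mul (K := ZMod 2) (W := W) hx
    have h2 := card_linearMap_collision_mul (K := ZMod 2) (W := Fin k → ZMod 2) hx
    have h3 : ({p : (V →ₗ[ZMod 2] W) × (V →ₗ[ZMod 2] (Fin k → ZMod 2)) |
        pairEval p x = pairEval p x'} : Finset _) =
        ({L : V →ₗ[ZMod 2] W | L x = L x'} : Finset _) ×ˢ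
          ({M : V →ₗ[ZMod 2] (Fin k → ZMod 2) | M x = M x'} : Finset _) := by
      ext p
      simp [pairEval]
    rw [h3, Finset.card_product, Fintype.card_prod, Fintype.card_prod, ← h1, ← h2]
    push_cast
    exact le_of_eq (by ring)

/-- The pairs `(L, M)` such that all loads over some `a` are atypical. -/
lemma card_exists_forall_mem_atypicalSlice_le (S : Finset V) (hS : S.Nonempty) (τ δ : ℝ)
    (hτ : 0 < τ) (hδ₀ : 0 < δ) (hδ₁ : δ < 1) (hW : Fintype.card W ≤ 2 ^ 2 ^ k)
    (hcard : 512 * 8 ^ k * Fintype.card W ≤ (τ * δ) ^ 2 * #S)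
    (l : ℝ) (hl : #S = l * (Fintype.card W * 2 ^ k)) :
    (#{p : (V →ₗ[ZMod 2] W) × (V →ₗ[ZMod 2] (Fin k → ZMod 2)) |
      ∃ a, ∀ b, a ∈ atypicalSlice S l (τ * l / 2) p b} : ℝ) ≤
      δ / 4 * Fintype.card ((V →ₗ[ZMod 2] W) × (V →ₗ[ZMod 2] (Fin k → ZMod 2))) := by
  have hWpos : (0 : ℝ) < Fintype.card W := by exact_mod_cast Fintype.card_pos
  have hSpos : (0 : ℝ) < #S := by exact_mod_cast hS.card_pos
  have hΩpos : (0 : ℝ) < Fintype.card ((V →ₗ[ZMod 2] W) × (V →ₗ[ZMod 2] (Fin k → ZMod 2))) := by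
    exact_mod_cast Fintype.card_pos
  have hlpos : 0 < l := by
    rw [hl] at hSpos
    exact pos_of_mul_pos_left hSpos (by positivity)
  let Ω := (V →ₗ[ZMod 2] W) × (V →ₗ[ZMod 2] (Fin k → ZMod 2))
  let A : Ω → (Fin k → ZMod 2) → Finset W := atypicalSlice S l (τ * l / 2)
  have hαpos : 0 < δ / (16 * 2 ^ k) := by positivity
  -- Shearing moves the randomness from the pair to the columns `w`.
  have hswap : (#{p : Ω | ∃ a, ∀ b, a ∈ A p b} : ℝ) * (Fintype.card W : ℝ) ^ k =
      ∑ p : Ω, (#{w : Fin k → W | ∃ a, ∀ b, a + ∑ i, b i • w i ∈ A p b} : ℝ) := by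
    simp_rw [← Finset.sum_boole]
    rw [Finset.sum_comm]
    have : ∀ w : Fin k → W,
        ∑ p : Ω, (if ∃ a, ∀ b, a + ∑ i, b i • w i ∈ A p b then (1 : ℝ) else 0) =
          ∑ p : Ω, if ∃ a, ∀ b, a ∈ A p b then (1 : ℝ) else 0 := by
      intro w
      rw [← Equiv.sum_comp (shearLinearMaps w)
        (fun p : Ω => if ∃ a, ∀ b, a ∈ A p b then (1 : ℝ) else 0)]
      refine Finset.sum_congr rfl fun p _ => ?_
      congr 1
      simp only [A, atypicalSlice, Finset.mem_filter, Finset.mem_univ, true_and,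
        hashLoad_shearLinearMaps]
    rw [Finset.sum_congr rfl fun w _ => this w]
    simp [mul_comm]
  have hpoint : ∀ p : Ω, (#{w : Fin k → W | ∃ a, ∀ b, a + ∑ i, b i • w i ∈ A p b} : ℝ) ≤
      (δ / 8 + (∑ b, (#(A p b) : ℝ)) / (δ / (16 * 2 ^ k) * Fintype.card W)) *
        (Fintype.card W : ℝ) ^ k :=
    fun p => card_exists_forall_add_mem_le_sum δ hδ₀ hδ₁ hW (A p)
  have hE : (#{p : Ω | ∃ a, ∀ b, a ∈ A p b} : ℝ) ≤
      δ / 8 * Fintype.card Ω + (∑ p : Ω, ∑ b, (#(A p b) : ℝ)) / (δ / (16 * 2 ^ k) * Fintype.card W) := by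
    refine le_of_mul_le_mul_right ?_ (pow_pos hWpos k)
    rw [hswap]
    refine (Finset.sum_le_sum fun p _ => hpoint p).trans (le_of_eq ?_)
    rw [← Finset.sum_mul, Finset.sum_add_distrib, Finset.sum_div]
    simp only [Finset.sum_const, Finset.card_univ, nsmul_eq_mul]
    ring
  -- By Markov this bounds the pairs with a non-sparse slice; after division by `|W| 2 ^ k`, `hcard`
  -- becomes the needed `512 * 4 ^ k ≤ (τ δ)² l`.
  have hA : (∑ p : Ω, ∑ b, (#(A p b) : ℝ)) / (δ / (16 * 2 ^ k) * Fintype.card W) ≤ δ / 8 * Fintype.card Ω := by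
    have h1 : (∑ p : Ω, ∑ b, (#(A p b) : ℝ)) * (τ * l / 2) ^ 2 ≤ #S * Fintype.card Ω :=
      sum_sum_card_atypicalSlice_mul_le S l (τ * l / 2) (by positivity) hl
    rw [div_le_iff₀ (by positivity)]
    have hpos : 0 < (τ * l / 2) ^ 2 := by positivity
    refine le_of_mul_le_mul_right (h1.trans ?_) hpos
    rw [mul_assoc, mul_assoc, mul_comm (#S : ℝ), mul_comm (δ / 8), mul_assoc]
    refine mul_le_mul_of_nonneg_left ?_ hΩpos.le
    have h2 : 512 * 4 ^ k ≤ (τ * δ) ^ 2 * l := by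
      have h8 : (8 : ℝ) ^ k = 4 ^ k * 2 ^ k := by rw [← mul_pow]; norm_num
      rw [hl, h8] at hcard
      refine le_of_mul_le_mul_right ?_ (by positivity : (0 : ℝ) < Fintype.card W * 2 ^ k)
      linarith
    have h4 : (4 : ℝ) ^ k = 2 ^ k * 2 ^ k := by rw [← mul_pow]; norm_num
    have h3 : δ / (16 * 2 ^ k) * Fintype.card W * (τ * l / 2) ^ 2 * (δ / 8) =
        (τ * δ) ^ 2 * l * (l * Fintype.card W) / (512 * 2 ^ k) := by
      field_simp
      norm_num
    rw [h3, hl, le_div_iff₀ (by positivity)]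
    calc l * (Fintype.card W * 2 ^ k) * (512 * 2 ^ k) = 512 * 4 ^ k * (l * Fintype.card W) := by
          rw [h4]; ring
      _ ≤ _ := by gcongr
  calc _ ≤ δ / 8 * Fintype.card Ω + (∑ p : Ω, ∑ b, (#(A p b) : ℝ)) / (δ / (16 * 2 ^ k) * Fintype.card W) := hE
    _ ≤ _ := by linarith

open scoped Classical in
/-- All but a `δ / 2` fraction of the linear maps hash `S` to within `τ` of uniform. -/
theorem card_exists_lt_abs_hashLoad_sub_le (S : Finset V) (hS : S.Nonempty) (τ δ : ℝ)
    (hτ : 0 < τ) (hδ₀ : 0 < δ) (hδ₁ : δ < 1) (hW : Fintype.card W ≤ 2 ^ 2 ^ k)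
    (hcard : 512 * 8 ^ k * (1 + τ) * Fintype.card W ≤ (τ * δ) ^ 2 * #S) :
    (#{L : V →ₗ[ZMod 2] W |
      ∃ y, τ * (#S / Fintype.card W) < |(hashLoad S L y : ℝ) - #S / Fintype.card W|} : ℝ) ≤
      δ / 2 * Fintype.card (V →ₗ[ZMod 2] W) := by
  have hWpos : (0 : ℝ) < Fintype.card W := by exact_mod_cast Fintype.card_pos
  have hSpos : (0 : ℝ) < #S := by exact_mod_cast hS.card_pos
  have hMpos : (0 : ℝ) < Fintype.card (V →ₗ[ZMod 2] (Fin k → ZMod 2)) := by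
    exact_mod_cast Fintype.card_pos
  obtain ⟨l, hl'⟩ : ∃ l : ℝ, l = #S / (Fintype.card W * 2 ^ k) := ⟨_, rfl⟩
  have hlpos : 0 < l := by rw [hl']; positivity
  have hl : #S = l * (Fintype.card W * 2 ^ k) := by rw [hl']; field_simp
  have hSW : (#S : ℝ) / Fintype.card W = l * 2 ^ k := by rw [hl]; field_simp
  have hcard' : 512 * 8 ^ k * Fintype.card W ≤ (τ * δ) ^ 2 * #S := by
    refine le_trans ?_ hcard
    refine mul_le_mul_of_nonneg_right ?_ hWpos.le
    exact le_mul_of_one_le_right (by positivity) (by linarith)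
  have hE := card_exists_forall_mem_atypicalSlice_le S hS τ δ hτ hδ₀ hδ₁ hW hcard' l hl
  have hbig : 16 * Fintype.card (Fin k → ZMod 2) * (1 + τ) ≤ τ ^ 2 * l := by
    have hB : (Fintype.card (Fin k → ZMod 2) : ℝ) = 2 ^ k := by simp
    have h8 : (8 : ℝ) ^ k = 2 ^ k * 2 ^ k * 2 ^ k := by rw [← mul_pow, ← mul_pow]; norm_num
    have h1 : (1 : ℝ) ≤ 2 ^ k := one_le_pow₀ (by norm_num)
    have h2 : 512 * (2 ^ k * 2 ^ k) * (1 + τ) ≤ (τ * δ) ^ 2 * l := by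
      rw [hl, h8] at hcard
      refine le_of_mul_le_mul_right ?_ (by positivity : (0 : ℝ) < Fintype.card W * 2 ^ k)
      linarith
    have h3 : (τ * δ) ^ 2 * l ≤ τ ^ 2 * l := by
      gcongr
      exact mul_le_of_le_one_right hτ.le hδ₁.le
    rw [hB]
    refine le_trans ?_ (h2.trans h3)
    refine mul_le_mul_of_nonneg_right ?_ (by linarith)
    nlinarith
  -- A bad fibre of `L` over `y` is the set `T` that `M` hashes; `a = y` is then the atypical
  -- column.
  have hhalf : ∀ L : V →ₗ[ZMod 2] W,
      (∃ y, τ * (#S / Fintype.card W) < |(hashLoad S L y : ℝ) - #S / Fintype.card W|) →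
      (Fintype.card (V →ₗ[ZMod 2] (Fin k → ZMod 2)) : ℝ) / 2 ≤
        #{M : V →ₗ[ZMod 2] (Fin k → ZMod 2) |
          ∃ a, ∀ b, a ∈ atypicalSlice S l (τ * l / 2) (L, M) b} := by
    rintro L ⟨y, hy⟩
    have hT : τ * l < |(#{x ∈ S | L x = y} : ℝ) / Fintype.card (Fin k → ZMod 2) - l| := by
      rw [hSW] at hy
      have h2 : (0 : ℝ) < 2 ^ k := by positivity
      have h3 : (#{x ∈ S | L x = y} : ℝ) / Fintype.card (Fin k → ZMod 2) - l =
          ((hashLoad S L y : ℝ) - l * 2 ^ k) / 2 ^ k := by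
        simp [hashLoad, sub_div]
      rw [h3, abs_div, abs_of_pos h2, lt_div_iff₀ h2]
      linarith
    refine (half_card_le_card_forall_le_abs_hashLoad_sub _ τ l hτ hlpos hbig hT).trans ?_
    norm_cast
    refine Finset.card_le_card fun M hM => ?_
    simp only [Finset.mem_filter, Finset.mem_univ, true_and, atypicalSlice] at hM ⊢
    refine ⟨y, fun b => ?_⟩
    have : hashLoad S (pairEval (L, M)) (y, b) = hashLoad {x ∈ S | L x = y} M b := by
      simp [hashLoad, pairEval, Finset.filter_filter]
    rw [this]
    exact hM b
  have hsum := card_filter_mul_le_sum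
    (fun L : V →ₗ[ZMod 2] W => (#{M : V →ₗ[ZMod 2] (Fin k → ZMod 2) |
          ∃ a, ∀ b, a ∈ atypicalSlice S l (τ * l / 2) (L, M) b} : ℝ))
    (fun L => Nat.cast_nonneg _) _ _ hhalf
  have hprod : ∑ L : V →ₗ[ZMod 2] W, (#{M : V →ₗ[ZMod 2] (Fin k → ZMod 2) |
        ∃ a, ∀ b, a ∈ atypicalSlice S l (τ * l / 2) (L, M) b} : ℝ) =
      #{p : (V →ₗ[ZMod 2] W) × (V →ₗ[ZMod 2] (Fin k → ZMod 2)) |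
        ∃ a, ∀ b, a ∈ atypicalSlice S l (τ * l / 2) p b} := by
    simp_rw [← Finset.sum_boole]
    rw [Fintype.sum_prod_type]
  rw [hprod] at hsum
  rw [Fintype.card_prod] at hE
  push_cast at hE
  have hfin := hsum.trans ((le_of_eq (by congr!)).trans hE)
  refine le_of_mul_le_mul_right ?_ (half_pos hMpos)
  linarith

end Shear

/-! ### Probability laws and restriction to surjective maps. -/

lemma hashLaw_apply_toReal {V W : Type*} [DecidableEq W] (S : Finset V)
    (hS : S.Nonempty) (L : V → W) (y : W) :
    (hashLaw S hS L y).toReal = hashLoad S L y / #S := by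
  classical
  have h : hashLaw S hS L y = ∑ x ∈ S, if L x = y then (#S : ENNReal)⁻¹ else 0 := by
    rw [hashLaw, PMF.map_apply, tsum_eq_sum (s := S)]
    · refine Finset.sum_congr rfl fun x hx => ?_
      rw [PMF.uniformOfFinset_apply_of_mem hS hx]
      simp [eq_comm]
    · intro x hx
      simp [PMF.uniformOfFinset_apply_of_notMem hS hx]
  rw [h, ← Finset.sum_filter, Finset.sum_const]
  simp [hashLoad, div_eq_mul_inv]

/-- The fraction of bad maps among the surjective ones is at most twice their fraction among all
linear maps. -/
theorem one_sub_mul_ncard_surjLinearMaps_le {n t k : ℕ} (S : Finset (Fin n → ZMod 2))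
    (hS : S.Nonempty) (τ δ : ℝ) (hτ : 0 < τ) (hδ₀ : 0 < δ) (hδ₁ : δ < 1) (hk : t ≤ 2 ^ k)
    (htn : t < n) (hcard : 512 * 8 ^ k * (1 + τ) * 2 ^ t ≤ (τ * δ) ^ 2 * #S) :
    (1 - δ) * ((surjLinearMaps n t).ncard : ℝ) ≤ ((goodLinearMaps S hS τ t).ncard : ℝ) := by
  classical
  have : Finite ((Fin n → ZMod 2) →ₗ[ZMod 2] (Fin t → ZMod 2)) := Module.finite_of_finite (ZMod 2)
  have : Finite ((Fin n → ZMod 2) →ₗ[ZMod 2] (Fin k → ZMod 2)) := Module.finite_of_finite (ZMod 2)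
  have := Fintype.ofFinite ((Fin n → ZMod 2) →ₗ[ZMod 2] (Fin t → ZMod 2))
  have := Fintype.ofFinite ((Fin n → ZMod 2) →ₗ[ZMod 2] (Fin k → ZMod 2))
  have hSpos : (0 : ℝ) < #S := by exact_mod_cast hS.card_pos
  have hWcard : Fintype.card (Fin t → ZMod 2) = 2 ^ t := by simp
  have hbad := card_exists_lt_abs_hashLoad_sub_le (W := Fin t → ZMod 2) (k := k) S hS τ δ hτ hδ₀
    hδ₁ (by rw [hWcard]; exact Nat.pow_le_pow_right (by norm_num) hk)
    (by rw [hWcard]; exact_mod_cast hcard)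
  set bad : Finset ((Fin n → ZMod 2) →ₗ[ZMod 2] (Fin t → ZMod 2)) := {L | ∃ y,
    τ * (#S / Fintype.card (Fin t → ZMod 2)) <
      |(hashLoad S L y : ℝ) - #S / Fintype.card (Fin t → ZMod 2)|} with hbad_def
  have hnot := card_not_surjective_mul_le (K := ZMod 2) (V := Fin n → ZMod 2)
    (W := Fin t → ZMod 2)
  have hsplit := Finset.card_filter_add_card_filter_not
    (s := (Finset.univ : Finset ((Fin n → ZMod 2) →ₗ[ZMod 2] (Fin t → ZMod 2))))
    (p := fun L => Function.Surjective L)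
  have hhalf : (Fintype.card ((Fin n → ZMod 2) →ₗ[ZMod 2] (Fin t → ZMod 2)) : ℝ) ≤
      2 * (surjLinearMaps n t).ncard := by
    have h1 : (surjLinearMaps n t).ncard =
        #{L : (Fin n → ZMod 2) →ₗ[ZMod 2] (Fin t → ZMod 2) | Function.Surjective L} := by
      rw [surjLinearMaps, ← Set.ncard_coe_finset]
      simp
    have h2 : 2 * #{L : (Fin n → ZMod 2) →ₗ[ZMod 2] (Fin t → ZMod 2) |
        ¬ Function.Surjective L} ≤
        Fintype.card ((Fin n → ZMod 2) →ₗ[ZMod 2] (Fin t → ZMod 2)) := by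
      have hpow : 2 * 2 ^ t ≤ 2 ^ n := by
        rw [← pow_succ']
        exact Nat.pow_le_pow_right (by norm_num) htn
      rw [hWcard, Fintype.card_fun, ZMod.card, Fintype.card_fin] at hnot
      refine Nat.le_of_mul_le_mul_left ?_ (pow_pos (by norm_num : 0 < 2) t)
      calc _ = #{L : (Fin n → ZMod 2) →ₗ[ZMod 2] (Fin t → ZMod 2) |
            ¬ Function.Surjective L} * (2 * 2 ^ t) := by ring
        _ ≤ _ := (Nat.mul_le_mul_left _ hpow).trans hnot
    rw [Finset.card_univ] at hsplit
    rw [h1]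
    have h3 : Fintype.card ((Fin n → ZMod 2) →ₗ[ZMod 2] (Fin t → ZMod 2)) ≤
      2 * #{L : (Fin n → ZMod 2) →ₗ[ZMod 2] (Fin t → ZMod 2) | Function.Surjective L} := by omega
    exact_mod_cast h3
  have hsub : surjLinearMaps n t ⊆ goodLinearMaps S hS τ t ∪ bad := by
    intro L hL
    by_cases hLb : L ∈ bad
    · exact Or.inr hLb
    · refine Or.inl ⟨hL, fun y => ?_⟩
      simp only [hbad_def, Finset.mem_filter, Finset.mem_univ, true_and, not_exists, not_lt,
        hWcard] at hLb
      have h2 := hLb y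
      push_cast at h2
      have h3 : (PMF.uniformOfFintype (Fin t → ZMod 2) y).toReal = (2 ^ t)⁻¹ := by
        rw [PMF.uniformOfFintype_apply, hWcard]
        simp
      rw [hashLaw_apply_toReal, h3]
      have h4 : (hashLoad S L y : ℝ) / #S - (2 ^ t)⁻¹ = (hashLoad S L y - #S / 2 ^ t) / #S := by
        field_simp
      rw [h4, abs_div, abs_of_pos hSpos, div_le_iff₀ hSpos]
      calc _ ≤ _ := h2
        _ = _ := by ring
  have hle : ((surjLinearMaps n t).ncard : ℝ) ≤ (goodLinearMaps S hS τ t).ncard + #bad := by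
    have := (Set.ncard_le_ncard hsub (Set.toFinite _)).trans (Set.ncard_union_le _ _)
    rw [Set.ncard_coe_finset] at this
    exact_mod_cast this
  -- Bad maps number at most `δ / 2` times all maps, hence at most `δ` times the surjective ones.
  nlinarith [mul_le_mul_of_nonneg_left hhalf hδ₀.le]

lemma one_sub_mul_ncard_surjLinearMaps_zero_le {n : ℕ} (S : Finset (Fin n → ZMod 2))
    (hS : S.Nonempty) (τ δ : ℝ) (hτ : 0 < τ) (hδ₀ : 0 < δ) :
    (1 - δ) * ((surjLinearMaps n 0).ncard : ℝ) ≤ ((goodLinearMaps S hS τ 0).ncard : ℝ) := by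
  have h : goodLinearMaps S hS τ 0 = surjLinearMaps n 0 := by
    refine Set.sep_eq_self_iff_mem_true.2 fun L _ y => ?_
    have hSpos : (#S : ℝ) ≠ 0 := by exact_mod_cast hS.card_pos.ne'
    have h1 : hashLoad S L y = #S := by
      rw [hashLoad, Finset.filter_true_of_mem fun x _ => Subsingleton.elim _ _]
    rw [hashLaw_apply_toReal, PMF.uniformOfFintype_apply, h1, div_self hSpos]
    simp [hτ.le]
  rw [h]
  have : (0 : ℝ) ≤ (surjLinearMaps n 0).ncard := Nat.cast_nonneg _
  nlinarith

/-! ### Choice of `t` and `k`. -/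

theorem mainTheorem4 (n : ℕ) (S : Finset (Fin n → ZMod 2)) (hS : S.Nonempty)
    (τ δ m : ℝ) (hτ : 0 < τ) (hδ₀ : 0 < δ) (hδ₁ : δ < 1)
    (hm : m = Real.logb 2 ((S.card : ℝ) * ((S.card : ℝ) - 1) / δ))
    (hcard : (S.card : ℝ) > 2 ^ 20 * m * max (2 ^ 8 * (1 + τ) ^ 4 / (τ * δ) ^ 8) 1)
    (hsize : m ≥ 5 * Real.logb 2 (m * max (4 * (1 + τ) / (τ * δ) ^ 2) 1) + 25) :
    ∃ t : ℕ, t ≤ n ∧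
      (t : ℝ) ≥ Real.logb 2 (S.card : ℝ)
        - 4 * Real.logb 2 (m * max (4 * (1 + τ) / (τ * δ) ^ 2) 1) - 20 ∧
      (1 - δ) * ((surjLinearMaps n t).ncard : ℝ) ≤ ((goodLinearMaps S hS τ t).ncard : ℝ) := by
  set Z : ℝ := max (4 * (1 + τ) / (τ * δ) ^ 2) 1 with hZ
  have hZ1 : 1 ≤ Z := le_max_right _ _
  have hZτ : 4 * (1 + τ) ≤ Z * (τ * δ) ^ 2 := by
    rw [← div_le_iff₀ (by positivity)]
    exact le_max_left _ _
  have hS1 : (1 : ℝ) ≤ #S := by exact_mod_cast hS.card_pos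
  have hS2 : (2 : ℝ) ≤ #S := by
    have h1 : #S ≠ 1 := by
      intro h1
      -- For a singleton both logarithms take the default value `logb 2 0 = 0`, and `hsize` would
      -- read `0 ≥ 25`.
      have hm0 : m = 0 := by rw [hm, h1]; simp
      rw [hm0] at hsize
      simp at hsize
      linarith
    have : 2 ≤ #S := by have := hS.card_pos; omega
    exact_mod_cast this
  have hSpos : (0 : ℝ) < #S := by linarith
  have hSm : Real.logb 2 #S ≤ m := by
    rw [hm]
    refine Real.logb_le_logb_of_le (by norm_num) hSpos ?_
    rw [le_div_iff₀ hδ₀]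
    nlinarith
  have hm1 : 1 ≤ m := by
    refine le_trans ?_ hSm
    rw [Real.le_logb_iff_rpow_le (by norm_num) hSpos]
    simpa using hS2
  set X := m * Z with hX
  have hX1 : 1 ≤ X := one_le_mul_of_one_le_of_one_le hm1 hZ1
  have hXpos : 0 < X := by linarith
  have hlog : Real.logb 2 #S - 4 * Real.logb 2 X - 20 = Real.logb 2 (#S / (2 ^ 20 * X ^ 4)) := by
    rw [Real.logb_div hSpos.ne' (by positivity), Real.logb_mul (by norm_num) (by positivity : X ^ 4 ≠ 0),
      Real.logb_pow, Real.logb_pow, Real.logb_self_eq_one (by norm_num)]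
    push_cast
    ring
  rw [hlog]
  have hR : 0 < #S / (2 ^ 20 * X ^ 4) := by positivity
  -- The natural ceiling is 0 exactly when the logarithm is nonpositive, which is the trivial case.
  set t := ⌈Real.logb 2 (#S / (2 ^ 20 * X ^ 4))⌉₊ with ht
  have htge : Real.logb 2 (#S / (2 ^ 20 * X ^ 4)) ≤ t := Nat.le_ceil _
  by_cases ht0 : t = 0
  · rw [ht0] at htge
    exact ⟨0, Nat.zero_le _, htge, one_sub_mul_ncard_surjLinearMaps_zero_le S hS τ δ hτ hδ₀⟩
  -- Rounding up costs less than a factor 2, hence `2 ^ 19` in place of `2 ^ 20`.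
  have htpow : (2 : ℝ) ^ t * (2 ^ 19 * X ^ 4) ≤ #S := by
    have hpos : 0 < Real.logb 2 (#S / (2 ^ 20 * X ^ 4)) := by
      by_contra! h
      exact ht0 (Nat.ceil_eq_zero.2 h)
    have h1 : (t : ℝ) < Real.logb 2 (#S / (2 ^ 20 * X ^ 4)) + 1 := Nat.ceil_lt_add_one hpos.le
    have h2 : ((t : ℝ) - 1) < Real.logb 2 (#S / (2 ^ 20 * X ^ 4)) := by linarith
    rw [Real.lt_logb_iff_rpow_lt (by norm_num) hR, Real.rpow_sub (by norm_num), Real.rpow_natCast,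
      Real.rpow_one, lt_div_iff₀ (by positivity)] at h2
    linarith
  have hSn : #S ≤ 2 ^ n := by
    have := Finset.card_le_univ S
    simpa using this
  have htn : t < n := by
    have h1 : (2 : ℝ) ^ t < #S := by
      refine lt_of_lt_of_le ?_ htpow
      have : 1 ≤ X ^ 4 := one_le_pow₀ hX1
      exact lt_mul_of_one_lt_right (by positivity) (by linarith)
    have h2 : 2 ^ t < 2 ^ n := lt_of_lt_of_le (by exact_mod_cast h1) hSn
    exact (Nat.pow_lt_pow_iff_right (by norm_num)).1 h2
  have htm : (t : ℝ) ≤ m := by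
    refine le_trans ?_ hSm
    rw [Real.le_logb_iff_rpow_le (by norm_num) hSpos, Real.rpow_natCast]
    refine le_trans ?_ htpow
    have : 1 ≤ X ^ 4 := one_le_pow₀ hX1
    exact le_mul_of_one_le_right (by positivity) (by linarith)
  -- The lower bound on `2 ^ k` gives `|W| ≤ 2 ^ 2 ^ k`; the upper bound keeps `8 ^ k` below `8 m³`,
  -- which `X ^ 4` absorbs.
  obtain ⟨k, hk, hk'⟩ : ∃ k, t ≤ 2 ^ k ∧ 2 ^ k ≤ 2 * t := by
    refine ⟨Nat.clog 2 t, Nat.le_pow_clog (by norm_num) t, ?_⟩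
    rcases Nat.lt_or_ge 1 t with h | h
    · have h1 := Nat.pow_pred_clog_lt_self (by norm_num : 1 < 2) h
      have h2 : 0 < Nat.clog 2 t := Nat.clog_pos (by norm_num) h
      obtain ⟨j, hj⟩ := Nat.exists_eq_succ_of_ne_zero h2.ne'
      rw [hj] at h1 ⊢
      rw [Nat.pred_succ] at h1
      rw [pow_succ]
      omega
    · have : t = 1 := by omega
      simp [this]
  refine ⟨t, htn.le, htge,
    one_sub_mul_ncard_surjLinearMaps_le S hS τ δ hτ hδ₀ hδ₁ hk htn ?_⟩
  have hkm : (2 : ℝ) ^ k ≤ 2 * m := by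
    have : (2 : ℝ) ^ k ≤ 2 * t := by exact_mod_cast hk'
    linarith
  have h8 : (8 : ℝ) ^ k ≤ 8 * m ^ 3 := by
    have : (8 : ℝ) ^ k = (2 ^ k) ^ 3 := by rw [← pow_mul, mul_comm, pow_mul]; norm_num
    rw [this]
    calc ((2 : ℝ) ^ k) ^ 3 ≤ (2 * m) ^ 3 := by gcongr
      _ = 8 * m ^ 3 := by ring
  have hmZ : m ^ 3 * Z ≤ X ^ 4 := by
    rw [hX, mul_pow]
    have h1 : m ^ 3 ≤ m ^ 4 := pow_le_pow_right₀ hm1 (by norm_num)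
    have h2 : Z ≤ Z ^ 4 := le_self_pow₀ hZ1 (by norm_num)
    gcongr
  calc 512 * 8 ^ k * (1 + τ) * 2 ^ t
      = 128 * 8 ^ k * (4 * (1 + τ)) * 2 ^ t := by ring
    _ ≤ 128 * (8 * m ^ 3) * (Z * (τ * δ) ^ 2) * 2 ^ t := by gcongr
    _ = (τ * δ) ^ 2 * (2 ^ t * (2 ^ 10 * (m ^ 3 * Z))) := by ring
    _ ≤ (τ * δ) ^ 2 * (2 ^ t * (2 ^ 19 * X ^ 4)) := by
        gcongr
        all_goals norm_num
    _ ≤ (τ * δ) ^ 2 * #S := by gcongr
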